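/- Let $G$ be a (discrete) group acting on a set $X$. Two subsets $A,B\subseteq X$ are called *equidecomposable* if there are finite partitions $A=\bigsqcup_{i=1}^n A_i$ and $B=\bigsqcup_{i=1}^n B_i$ and elements $s_1,\dots,s_n\in G$ such that $B_i=s_iA_i$ for $1\le i\le n$. The action is called *locally finite* if, for every finitely generated subgroup $H$ of $G$ and every $x\in X$, the $H$-orbit of $x$ is finite. Let $\ell^\infty(X)$ be the C*-algebra of bounded complex-valued functions on $X$, with the $G$-action $(s\cdot f)(x)=f(s^{-1}x)$, represented on $\ell^2(X)$ by multiplication operators. The reduced crossed product $\ell^\infty(X)\rtimes_r G$ is the C*-algebra of bounded operators on $\ell^2(G,\ell^2(X))$ generated by the operators $(\tilde\pi(f)\xi)(g)=(g^{-1}\cdot f)\,\xi(g)$ for $f\in\ell^\infty(X)$ and $(\lambda_s\xi)(g)=\xi(s^{-1}g)$ for $s\in G$. A unital C*-algebra is called *finite* if $v^*v=1$ implies $vv^*=1$ for each of its elements $v$. The following conditions are equivalent: 1. The action of $G$ on $X$ is locally finite. 2. The C*-algebra $\ell^\infty(X)\rtimes_r G$ is finite. 3. $X$ is not equidecomposable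 with a proper subset of itself. 4. No subset of $X$ is equidecomposable with a proper subset of itself. -/

import Mathlib

open scoped ENNReal Pointwise lp

noncomputable section

namespace CrossedProduct

/-! ### Locally finite actions and equidecomposability -/

/-- An action of `G` on `X` is locally finite if every orbit of every finitely generated
subgroup of `G` is finite. -/
def LocallyFiniteAction (G X : Type*) [Group G] [MulAction G X] : Prop :=
  ∀ H : Subgroup G, H.FG → ∀ x : X, (MulAction.orbit H x).Finite

/-- `A` and `B` are equidecomposable: there are finite partitions `P 1, …, P n` of `A` and
`Q 1, …, Q n` of `B` and elements `s 1, …, s n` of `G` with `Q i = s i • P i`. (Empty pieces are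
allowed; dropping them does not change the notion.) -/
def Equidecomposable (G : Type*) {X : Type*} [Group G] [MulAction G X] (A B : Set X) : Prop :=
  ∃ (n : ℕ) (P Q : Fin n → Set X) (s : Fin n → G),
    (Pairwise fun i j => Disjoint (P i) (P j)) ∧ (⋃ i, P i) = A ∧
    (Pairwise fun i j => Disjoint (Q i) (Q j)) ∧ (⋃ i, Q i) = B ∧
    ∀ i, Q i = s i • P i

/-! ### Finite unital C⋆-algebras -/

/-- A unital C⋆-algebra is finite if every isometry in it is unitary, i.e. if its unit is not
Murray-von Neumann equivalent to a proper subprojection. -/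
def IsFiniteCStarAlgebra (A : Type*) [CStarAlgebra A] : Prop :=
  ∀ v : A, star v * v = 1 → v * star v = 1

/-! ### The reduced crossed product of a C⋆-dynamical system -/

section Reduced

variable {G A H : Type*} [Group G] [CStarAlgebra A]
  [NormedAddCommGroup H] [InnerProductSpace ℂ H]

/-- The left translation `(λ_s ξ)(g) = ξ(s⁻¹ g)` on `ℓ²(G, H)`. -/
def translation (H : Type*) [NormedAddCommGroup H] [InnerProductSpace ℂ H] (s : G) :
    ℓ²(G, H) →L[ℂ] ℓ²(G, H) :=
  LinearMap.mkContinuous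
    { toFun := fun ξ => ⟨fun g => ξ (s⁻¹ * g), by
        have h := (lp.memℓp ξ).summable (by norm_num)
        exact memℓp_gen ((Equiv.mulLeft s⁻¹).summable_iff.mpr h)⟩
      map_add' := fun _ _ => rfl
      map_smul' := fun _ _ => rfl } 1 <| fun ξ => by
    rw [one_mul, lp.norm_eq_tsum_rpow (by norm_num), lp.norm_eq_tsum_rpow (by norm_num)]
    exact le_of_eq (congrArg (· ^ (1 / (2 : ℝ≥0∞).toReal))
      ((Equiv.mulLeft s⁻¹).tsum_eq fun g => ‖ξ g‖ ^ (2 : ℝ≥0∞).toReal))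

@[simp] theorem translation_apply (s g : G) (ξ : ℓ²(G, H)) :
    translation H s ξ g = ξ (s⁻¹ * g) := rfl

variable [CompleteSpace H]

/-- Given a representation `π : A → B(H)` and an action `α` of `G` on `A`, the operator on
`ℓ²(G, H)` given by `(π̃(a) ξ)(g) = π(α_{g⁻¹}(a)) ξ(g)`. -/
def diagonal (π : A →⋆ₐ[ℂ] (H →L[ℂ] H)) (α : G →* (A ≃⋆ₐ[ℂ] A)) (a : A) :
    ℓ²(G, H) →L[ℂ] ℓ²(G, H) :=
  lp.mapCLM 2 (fun g => π (α g⁻¹ a)) (norm_nonneg a) fun g =>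
    (NonUnitalStarAlgHom.norm_apply_le π _).trans (StarAlgEquiv.norm_map (α g⁻¹) a).le

@[simp] theorem diagonal_apply (π : A →⋆ₐ[ℂ] (H →L[ℂ] H)) (α : G →* (A ≃⋆ₐ[ℂ] A)) (a : A)
    (ξ : ℓ²(G, H)) (g : G) : diagonal π α a ξ g = π (α g⁻¹ a) (ξ g) := rfl

/-- The reduced crossed product `A ⋊_{α,r} G` of a unital C⋆-algebra `A` by an action `α` of the
discrete group `G`, realised through a representation `π` of `A` on a Hilbert space `H`: the
C⋆-algebra of operators on `ℓ²(G, H)` generated by the operators `π̃(a)`, `a ∈ A`, and `λ_s`,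
`s ∈ G`. This is the usual reduced crossed product when `π` is faithful (and is then independent
of the choice of `π`). -/
def reducedCrossedProduct (π : A →⋆ₐ[ℂ] (H →L[ℂ] H)) (α : G →* (A ≃⋆ₐ[ℂ] A)) :
    StarSubalgebra ℂ (ℓ²(G, H) →L[ℂ] ℓ²(G, H)) :=
  (StarAlgebra.adjoin ℂ
    (Set.range (diagonal π α) ∪ Set.range (translation (G := G) H))).topologicalClosure

instance reducedCrossedProduct.instCStarAlgebra (π : A →⋆ₐ[ℂ] (H →L[ℂ] H)) (α : G →* (A ≃⋆ₐ[ℂ] A)) :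
    CStarAlgebra (reducedCrossedProduct π α) :=
  haveI : IsClosed (reducedCrossedProduct π α : Set (ℓ²(G, H) →L[ℂ] ℓ²(G, H))) :=
    StarSubalgebra.isClosed_topologicalClosure _
  inferInstance

end Reduced

/-! ### The C⋆-dynamical system of an action on a set -/

/-- The representation of `ℓ^∞(X)` on `ℓ²(X)` by multiplication operators. -/
def multiplication (X : Type*) : ℓ^∞(X, ℂ) →⋆ₐ[ℂ] (ℓ²(X, ℂ) →L[ℂ] ℓ²(X, ℂ)) where
  toFun f := lp.mapCLM 2 (fun x => ContinuousLinearMap.mul ℂ ℂ (f x)) (norm_nonneg f) fun x => by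
    simpa using lp.norm_apply_le_norm ENNReal.top_ne_zero f x
  map_one' := by ext ξ x; exact one_mul _
  map_mul' f g := by ext ξ x; exact mul_assoc _ _ _
  map_zero' := by ext ξ x; exact zero_mul _
  map_add' f g := by ext ξ x; exact add_mul _ _ _
  commutes' c := by ext ξ x; rfl
  map_star' f := by
    rw [ContinuousLinearMap.star_eq_adjoint, ContinuousLinearMap.eq_adjoint_iff]
    intro ξ η
    rw [lp.inner_eq_tsum, lp.inner_eq_tsum]
    refine tsum_congr fun x => ?_
    change inner ℂ (star (f x) * ξ x) (η x) = inner ℂ (ξ x) (f x * η x)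
    simp
    ring

@[simp] theorem multiplication_apply {X : Type*} (f : ℓ^∞(X, ℂ)) (ξ : ℓ²(X, ℂ)) (x : X) :
    multiplication X f ξ x = f x * ξ x := rfl

theorem multiplication_injective (X : Type*) : Function.Injective (multiplication X) := by
  classical
  intro f g h
  ext x
  have := congrArg (fun T : ℓ²(X, ℂ) →L[ℂ] ℓ²(X, ℂ) => T (lp.single 2 x 1) x) h
  simpa using this

/-- The action of `G` on `ℓ^∞(X)` induced by an action on `X`: `(s · f)(x) = f(s⁻¹ x)`. -/
def translationAction (G X : Type*) [Group G] [MulAction G X] :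
    G →* (ℓ^∞(X, ℂ) ≃⋆ₐ[ℂ] ℓ^∞(X, ℂ)) where
  toFun s :=
    { toFun := fun f => ⟨fun x => f (s⁻¹ • x), memℓp_infty (by
        obtain ⟨C, hC⟩ := (lp.memℓp f).bddAbove
        exact ⟨C, by rintro _ ⟨x, rfl⟩; exact hC ⟨s⁻¹ • x, rfl⟩⟩)⟩
      invFun := fun f => ⟨fun x => f (s • x), memℓp_infty (by
        obtain ⟨C, hC⟩ := (lp.memℓp f).bddAbove
        exact ⟨C, by rintro _ ⟨x, rfl⟩; exact hC ⟨s • x, rfl⟩⟩)⟩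
      left_inv := fun f => by ext x; simp
      right_inv := fun f => by ext x; simp
      map_mul' := fun _ _ => rfl
      map_add' := fun _ _ => rfl
      map_star' := fun _ => rfl
      map_smul' := fun _ _ => rfl }
  map_one' := by ext f x; simp
  map_mul' s t := by
    ext f x
    change f ((s * t)⁻¹ • x) = f (t⁻¹ • s⁻¹ • x)
    rw [mul_inv_rev, mul_smul]

@[simp] theorem translationAction_apply {G X : Type*} [Group G] [MulAction G X] (s : G)
    (f : ℓ^∞(X, ℂ)) (x : X) : translationAction G X s f x = f (s⁻¹ • x) := rfl

/-- The reduced crossed product `ℓ^∞(X) ⋊_r G`, constructed from the faithful representation of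
`ℓ^∞(X)` on `ℓ²(X)` by multiplication operators. -/
abbrev lInftyCrossedProduct (G X : Type*) [Group G] [MulAction G X] :
    StarSubalgebra ℂ (ℓ²(G, ℓ²(X, ℂ)) →L[ℂ] ℓ²(G, ℓ²(X, ℂ))) :=
  reducedCrossedProduct (multiplication X) (translationAction G X)

end CrossedProduct

end

/-! Failure of local finiteness yields paradoxes; local finiteness yields enough traces to exclude
proper isometries.

If a finitely generated subgroup has an infinite orbit, König's lemma produces a ray in its Schreier
graph along which the distance to the base point strictly increases
(`exists_injective_seq_of_infinite`). Shifting along the ray and fixing all other points is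
injective, misses the starting point and uses finitely many group elements
(`exists_equidecomposable_of_injective_seq`). An equidecomposition of `X` with a proper subset gives
in turn a non-unitary isometry, a sum of translations cut down by indicator functions
(`not_equidecomposable_of_isFinite`).

Conversely, let the action be locally finite. An element `a` of the algebraic crossed product
involves finitely many group elements, so each point of `X` lies in a finite set `O` invariant under
them. Summing the diagonal coefficients at `(1, y)`, `y ∈ O`, gives a functional that is tracial for
`a` against every operator commuting with the right translations
(`exists_finite_partialTrace_comm`). If `a⋆a` is invertible, the complement of the range projection
of `a` has trace zero for all these sets, hence vanishes, and `a` is invertible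
(`isUnit_of_locallyFinite`). Since invertibility is an open condition, this passes to isometries in
the closure (`mul_star_eq_one_of_mem_closure`). -/

noncomputable section

namespace CrossedProduct

/-! ### Equidecompositions from piecewise translations -/

section Equidecomposition

variable {G X : Type*} [Group G] [MulAction G X]

/-- An injective self-map that is given piecewise by finitely many group elements realises an
equidecomposition of the whole set with its range. -/
theorem equidecomposable_univ_range {f : X → X} (hf : Function.Injective f) {F : Set G}
    (hF : F.Finite) (h : ∀ x, ∃ s ∈ F, f x = s • x) :
    Equidecomposable G Set.univ (Set.range f) := by
  choose c hcF hc using h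
  have := hF.to_subtype
  obtain ⟨n, ⟨e⟩⟩ := Finite.exists_equiv_fin F
  have himage (i : Fin n) : ((e.symm i : F) : G) • {x | c x = e.symm i} =
      f '' {x | c x = e.symm i} := by
    ext y
    constructor
    · rintro ⟨x, hx, rfl⟩
      refine ⟨x, hx, ?_⟩
      rw [hc x, show c x = e.symm i from hx]
    · rintro ⟨x, hx, rfl⟩
      refine ⟨x, hx, ?_⟩
      rw [hc x, show c x = e.symm i from hx]
  have hdisj : Pairwise fun i j : Fin n =>
      Disjoint {x | c x = e.symm i} {x | c x = e.symm j} := by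
    intro i j hij
    rw [Set.disjoint_left]
    intro x hx hx'
    exact hij (e.symm.injective (Subtype.ext (hx.symm.trans hx')))
  have hunion : (⋃ i : Fin n, {x | c x = e.symm i}) = Set.univ := by
    ext x
    refine ⟨fun _ => trivial, fun _ => Set.mem_iUnion.2 ⟨e ⟨c x, hcF x⟩, ?_⟩⟩
    change c x = _
    simp
  refine ⟨n, fun i => {x | c x = e.symm i}, fun i => f '' {x | c x = e.symm i},
    fun i => e.symm i, hdisj, hunion, ?_, ?_, fun i => (himage i).symm⟩
  · intro i j hij
    exact (Set.disjoint_image_iff hf).2 (hdisj hij)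
  · rw [← Set.image_iUnion, hunion, Set.image_univ]

/-- An equidecomposition of a set with a subset of it extends by the identity on the complement. -/
theorem Equidecomposable.univ_union_compl {A B : Set X} (hBA : B ⊆ A)
    (h : Equidecomposable G A B) : Equidecomposable G Set.univ (B ∪ Aᶜ) := by
  obtain ⟨n, P, Q, s, hP, rfl, hQ, rfl, hs⟩ := h
  have hPd (i : Fin n) : Disjoint (P i) (⋃ i, P i)ᶜ :=
    Set.disjoint_compl_right_iff_subset.2 (Set.subset_iUnion P i)
  have hQd (i : Fin n) : Disjoint (Q i) (⋃ i, P i)ᶜ :=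
    Set.disjoint_compl_right_iff_subset.2 ((Set.subset_iUnion Q i).trans hBA)
  have key (R : Fin n → Set X) (hR : Pairwise fun i j => Disjoint (R i) (R j)) (C : Set X)
      (hRC : ∀ i, Disjoint (R i) C) : Pairwise fun i j =>
        Disjoint (Fin.cons (α := fun _ => Set X) C R i) (Fin.cons (α := fun _ => Set X) C R j) := by
    intro i j hij
    induction i using Fin.cases with
    | zero =>
      induction j using Fin.cases with
      | zero => exact absurd rfl hij
      | succ j => simpa using (hRC j).symm
    | succ i =>
      induction j using Fin.cases with
      | zero => simpa using hRC i
      | succ j => simpa using hR fun h => hij (congrArg Fin.succ h)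
  have hunion (R : Fin n → Set X) (C : Set X) :
      (⋃ i, Fin.cons (α := fun _ => Set X) C R i) = (⋃ i, R i) ∪ C := by
    ext x
    simp [or_comm]
  refine ⟨n + 1, Fin.cons (⋃ i, P i)ᶜ P, Fin.cons (⋃ i, P i)ᶜ Q, Fin.cons 1 s,
    key P hP _ hPd, ?_, key Q hQ _ hQd, hunion _ _, ?_⟩
  · rw [hunion, Set.union_compl_self]
  · intro i
    induction i using Fin.cases with
    | zero => simp
    | succ i => simpa using hs i

/-- A sequence of distinct points, each obtained from the previous one by an element of a fixed
finite set, makes the whole set equidecomposable with a proper subset. -/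
theorem exists_equidecomposable_of_injective_seq {F : Set G} (hF : F.Finite) {u : ℕ → X}
    (hu : Function.Injective u) (h : ∀ n, ∃ s ∈ F, u (n + 1) = s • u n) :
    ∃ B : Set X, B ⊂ Set.univ ∧ Equidecomposable G Set.univ B := by
  classical
  -- The shift `u i ↦ u (i + 1)`, extended by the identity; its range misses `u 0`.
  let f : X → X := fun z => if h : ∃ i, u i = z then u (h.choose + 1) else z
  have hfu (i : ℕ) : f (u i) = u (i + 1) := by
    have hi : ∃ j, u j = u i := ⟨i, rfl⟩
    simp only [f, dif_pos hi]
    rw [hu hi.choose_spec]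
  have hfn {z : X} (hz : ¬ ∃ i, u i = z) : f z = z := dif_neg hz
  have hinj : Function.Injective f := by
    intro y z hyz
    by_cases hy : ∃ i, u i = y <;> by_cases hz : ∃ i, u i = z
    · obtain ⟨i, rfl⟩ := hy
      obtain ⟨j, rfl⟩ := hz
      rw [hfu, hfu] at hyz
      rw [Nat.succ_injective (hu hyz)]
    · obtain ⟨i, rfl⟩ := hy
      rw [hfu, hfn hz] at hyz
      exact absurd ⟨_, hyz⟩ hz
    · obtain ⟨j, rfl⟩ := hz
      rw [hfu, hfn hy] at hyz
      exact absurd ⟨_, hyz.symm⟩ hy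
    · rwa [hfn hy, hfn hz] at hyz
  refine ⟨Set.range f, (Set.ssubset_univ_iff).2 fun hr => ?_,
    equidecomposable_univ_range hinj (hF.insert 1) fun z => ?_⟩
  · obtain ⟨z, hz⟩ : u 0 ∈ Set.range f := hr ▸ Set.mem_univ _
    by_cases hz' : ∃ i, u i = z
    · obtain ⟨i, rfl⟩ := hz'
      rw [hfu] at hz
      exact absurd (hu hz) (Nat.succ_ne_zero i)
    · rw [hfn hz'] at hz
      exact hz' ⟨0, hz.symm⟩
  · by_cases hz : ∃ i, u i = z
    · obtain ⟨i, rfl⟩ := hz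
      obtain ⟨s, hs, hsu⟩ := h i
      exact ⟨s, Set.mem_insert_of_mem _ hs, (hfu i).trans hsu⟩
    · exact ⟨1, Set.mem_insert _ _, by rw [hfn hz, one_smul]⟩

/-! ### Word distance and rays in Schreier graphs -/

/-- The points that can be reached from `x` by applying `n` elements of `F`. -/
def reach (F : Set G) (x : X) : ℕ → Set X
  | 0 => {x}
  | n + 1 => F • reach F x n

/-- The least number of elements of `F` needed to reach `y` from `x`. -/
def wordDist (F : Set G) (x y : X) : ℕ := sInf {n | y ∈ reach F x n}

theorem exists_mem_reach {F : Set G} {x : X} {g : G} (hg : g ∈ Submonoid.closure F) :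
    ∃ n, g • x ∈ reach F x n := by
  induction hg using Submonoid.closure_induction_left with
  | one => exact ⟨0, one_smul G x⟩
  | mul_left s hs g _ ih =>
    obtain ⟨n, hn⟩ := ih
    exact ⟨n + 1, s, hs, g • x, hn, (mul_smul s g x).symm⟩

/-- One step along an edge of the Schreier graph that increases the distance to `x`. -/
def OutwardStep (F : Set G) (x y z : X) : Prop :=
  ∃ s ∈ F, z = s • y ∧ wordDist F x z = wordDist F x y + 1

/-- A shortest word from `x` to `y` moves outward at every step. Reachability must be assumed
because `sInf ∅ = 0` would put unreachable points at distance zero. -/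
theorem reflTransGen_outwardStep {F : Set G} {x : X} (n : ℕ) :
    ∀ y, (∃ m, y ∈ reach F x m) → wordDist F x y = n →
      Relation.ReflTransGen (OutwardStep F x) x y := by
  induction n with
  | zero =>
    intro y hy hd
    have : y ∈ reach F x (wordDist F x y) := Nat.sInf_mem hy
    rw [hd] at this
    rw [show y = x from this]
  | succ n ih =>
    intro y hy hd
    have hmem : y ∈ reach F x (wordDist F x y) := Nat.sInf_mem hy
    rw [hd] at hmem
    obtain ⟨s, hs, z, hz, rfl⟩ := hmem
    -- The penultimate point is at distance exactly `n`: at most `n` by the word used, and no less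
    -- since one more letter leads to distance `n + 1`.
    have hle : wordDist F x z ≤ n := Nat.sInf_le hz
    have hz' : z ∈ reach F x (wordDist F x z) := Nat.sInf_mem (s := {m | z ∈ reach F x m}) ⟨n, hz⟩
    have hge : wordDist F x (s • z) ≤ wordDist F x z + 1 := Nat.sInf_le ⟨s, hs, z, hz', rfl⟩
    have heq : wordDist F x z = n := by
      change wordDist F x (s • z) = n + 1 at hd
      omega
    exact (ih z ⟨n, hz⟩ heq).tail ⟨s, hs, rfl, by rw [heq]; exact hd⟩

/-- A finitely generated group with an infinite orbit admits an infinite ray in this orbit. -/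
theorem exists_injective_seq_of_infinite {F : Set G} (hF : F.Finite) {x : X}
    (hx : {y | Relation.ReflTransGen (OutwardStep F x) x y}.Infinite) :
    ∃ u : ℕ → X, Function.Injective u ∧ ∀ n, ∃ s ∈ F, u (n + 1) = s • u n := by
  -- König's lemma: follow points with infinitely many descendants. There are finitely many outward
  -- steps from `y`, so if each led to a finite set of descendants, `D y` would be finite.
  let D (y : X) : Set X := {z | Relation.ReflTransGen (OutwardStep F x) y z}
  have hstep (y : {y : X // (D y).Infinite}) :
      ∃ z : {y : X // (D y).Infinite}, OutwardStep F x y.1 z.1 := by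
    obtain ⟨y, hy⟩ := y
    by_contra! hcon
    refine hy (Set.Finite.subset ((Set.finite_singleton y).union
      (Set.Finite.biUnion (t := D)
        (s := {z | OutwardStep F x y z}) ((hF.image (· • y)).subset ?_) ?_)) ?_)
    · rintro z ⟨s, hs, rfl, _⟩
      exact ⟨s, hs, rfl⟩
    · intro z hz
      by_contra hinf
      exact hcon ⟨z, hinf⟩ hz
    · intro z hz
      rcases Relation.ReflTransGen.cases_head hz with rfl | ⟨w, hw, hwz⟩
      · exact Or.inl rfl
      · exact Or.inr (Set.mem_biUnion hw hwz)
  choose next hnext using hstep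
  let v : ℕ → {y : X // (D y).Infinite} := fun n => next^[n] ⟨x, hx⟩
  have hv (n : ℕ) : OutwardStep F x (v n).1 (v (n + 1)).1 := by
    simp only [v, Function.iterate_succ_apply']
    exact hnext _
  refine ⟨fun n => (v n).1, ?_, fun n => ?_⟩
  · refine Function.Injective.of_comp (f := wordDist F x) (StrictMono.injective ?_)
    refine strictMono_nat_of_lt_succ fun n => ?_
    obtain ⟨s, -, -, h⟩ := hv n
    simp only [Function.comp_apply, h]
    exact Nat.lt_succ_self _
  · obtain ⟨s, hs, h, -⟩ := hv n
    exact ⟨s, hs, h⟩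

/-- If `X` is not equidecomposable with a proper subset, then the action is locally finite. -/
theorem locallyFiniteAction_of_not_equidecomposable
    (h : ¬ ∃ B : Set X, B ⊂ Set.univ ∧ Equidecomposable G Set.univ B) :
    LocallyFiniteAction G X := by
  intro H hH x
  by_contra hinf
  obtain ⟨S, rfl⟩ := hH
  -- Adding inverses makes the submonoid generated equal to the subgroup, so words without inverses
  -- reach the whole orbit.
  have hF : ((S : Set G) ∪ (S : Set G)⁻¹).Finite := S.finite_toSet.union S.finite_toSet.inv
  have hx : {y | Relation.ReflTransGen
      (OutwardStep ((S : Set G) ∪ (S : Set G)⁻¹) x) x y}.Infinite := by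
    refine Set.Infinite.mono ?_ hinf
    rintro _ ⟨⟨g, hg⟩, rfl⟩
    rw [← Subgroup.mem_toSubmonoid, Subgroup.closure_toSubmonoid] at hg
    exact reflTransGen_outwardStep _ _ (exists_mem_reach hg) rfl
  obtain ⟨u, hu, hs⟩ := exists_injective_seq_of_infinite hF hx
  exact h (exists_equidecomposable_of_injective_seq hF hu hs)

end Equidecomposition

/-! ### Adjoints of the generators -/

section Operators

variable {G A H : Type*} [Group G] [CStarAlgebra A]
  [NormedAddCommGroup H] [InnerProductSpace ℂ H] [CompleteSpace H]

theorem star_translation (s : G) : star (translation H s) = translation H s⁻¹ := by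
  rw [ContinuousLinearMap.star_eq_adjoint, eq_comm, ContinuousLinearMap.eq_adjoint_iff]
  intro ξ η
  rw [lp.inner_eq_tsum, lp.inner_eq_tsum, ← (Equiv.mulLeft s⁻¹).tsum_eq]
  refine tsum_congr fun g => ?_
  simp

theorem star_diagonal (π : A →⋆ₐ[ℂ] (H →L[ℂ] H)) (α : G →* (A ≃⋆ₐ[ℂ] A)) (a : A) :
    star (diagonal π α a) = diagonal π α (star a) := by
  rw [ContinuousLinearMap.star_eq_adjoint, eq_comm, ContinuousLinearMap.eq_adjoint_iff]
  intro ξ η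
  rw [lp.inner_eq_tsum, lp.inner_eq_tsum]
  refine tsum_congr fun g => ?_
  rw [diagonal_apply, diagonal_apply, map_star, map_star, ContinuousLinearMap.star_eq_adjoint,
    ContinuousLinearMap.adjoint_inner_left]

/-- The generating set is closed under adjoints, so inductions over the algebraic crossed product
need no case for the star. -/
theorem adjoin_generators_eq (π : A →⋆ₐ[ℂ] (H →L[ℂ] H)) (α : G →* (A ≃⋆ₐ[ℂ] A)) :
    (StarAlgebra.adjoin ℂ
      (Set.range (diagonal π α) ∪ Set.range (translation (G := G) H))).toSubalgebra =
    Algebra.adjoin ℂ (Set.range (diagonal π α) ∪ Set.range (translation (G := G) H)) := by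
  rw [StarAlgebra.adjoin_toSubalgebra]
  congr 1
  refine Set.union_eq_self_of_subset_right ?_
  intro T hT
  rw [Set.mem_star] at hT
  rw [← star_star T]
  rcases hT with ⟨a, ha⟩ | ⟨s, hs⟩
  · exact Or.inl ⟨star a, by rw [← star_diagonal, ha]⟩
  · exact Or.inr ⟨s⁻¹, by rw [← star_translation, hs]⟩

theorem diagonal_mem (π : A →⋆ₐ[ℂ] (H →L[ℂ] H)) (α : G →* (A ≃⋆ₐ[ℂ] A)) (a : A) :
    diagonal π α a ∈ reducedCrossedProduct π α :=
  StarSubalgebra.le_topologicalClosure _ (StarAlgebra.subset_adjoin _ _ (Or.inl ⟨a, rfl⟩))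

theorem translation_mem (π : A →⋆ₐ[ℂ] (H →L[ℂ] H)) (α : G →* (A ≃⋆ₐ[ℂ] A)) (s : G) :
    translation H s ∈ reducedCrossedProduct π α :=
  StarSubalgebra.le_topologicalClosure _ (StarAlgebra.subset_adjoin _ _ (Or.inr ⟨s, rfl⟩))

end Operators

section Evaluation

variable {G X : Type*}

/-- Evaluation of a vector at a point of `G × X`. -/
def evalAt (g : G) (x : X) : ℓ²(G, ℓ²(X, ℂ)) →ₗ[ℂ] ℂ where
  toFun ξ := ξ g x
  map_add' _ _ := rfl
  map_smul' _ _ := rfl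

theorem evalAt_apply (g : G) (x : X) (ξ : ℓ²(G, ℓ²(X, ℂ))) : evalAt g x ξ = ξ g x := rfl

end Evaluation

/-! ### The isometry implementing an equidecomposition -/

section Finite

variable {G X : Type*} [Group G] [MulAction G X]

/-- The indicator function of a set, as a bounded function. -/
def indicatorFunction (A : Set X) : ℓ^∞(X, ℂ) :=
  ⟨A.indicator 1, memℓp_infty ⟨1, by
    classical
    rintro _ ⟨x, rfl⟩
    by_cases h : x ∈ A <;> simp [h]⟩⟩

theorem indicatorFunction_apply (A : Set X) (x : X) :
    indicatorFunction A x = A.indicator 1 x := rfl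

theorem star_indicatorFunction (A : Set X) : star (indicatorFunction A) = indicatorFunction A := by
  classical
  ext x
  rw [lp.star_apply, indicatorFunction_apply]
  by_cases h : x ∈ A <;> simp [h]

theorem diagonal_apply_apply (f : ℓ^∞(X, ℂ)) (ξ : ℓ²(G, ℓ²(X, ℂ))) (g : G) (x : X) :
    diagonal (multiplication X) (translationAction G X) f ξ g x = f (g • x) * ξ g x := by
  rw [diagonal_apply, multiplication_apply, translationAction_apply, inv_inv]

/-- The partial isometry implementing an equidecomposition. -/
def piecewiseTranslation {n : ℕ} (P : Fin n → Set X) (s : Fin n → G) :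
    ℓ²(G, ℓ²(X, ℂ)) →L[ℂ] ℓ²(G, ℓ²(X, ℂ)) :=
  ∑ i, translation _ (s i) *
    diagonal (multiplication X) (translationAction G X) (indicatorFunction (P i))

theorem piecewiseTranslation_mem {n : ℕ} (P : Fin n → Set X) (s : Fin n → G) :
    piecewiseTranslation P s ∈ lInftyCrossedProduct G X :=
  sum_mem fun _ _ => mul_mem (translation_mem _ _ _) (diagonal_mem _ _ _)

theorem piecewiseTranslation_apply {n : ℕ} (P : Fin n → Set X) (s : Fin n → G)
    (ξ : ℓ²(G, ℓ²(X, ℂ))) (g : G) (x : X) :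
    piecewiseTranslation P s ξ g x =
      ∑ i, (P i).indicator 1 ((s i)⁻¹ • g • x) * ξ ((s i)⁻¹ * g) x := by
  rw [← evalAt_apply, piecewiseTranslation, sum_apply, map_sum]
  refine Finset.sum_congr rfl fun i _ => ?_
  rw [evalAt_apply, mul_apply_eq_comp, translation_apply, diagonal_apply_apply,
    mul_smul, indicatorFunction_apply]

theorem star_piecewiseTranslation_apply {n : ℕ} (P : Fin n → Set X) (s : Fin n → G)
    (ξ : ℓ²(G, ℓ²(X, ℂ))) (g : G) (x : X) :
    star (piecewiseTranslation P s) ξ g x =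
      ∑ i, (P i).indicator 1 (g • x) * ξ (s i * g) x := by
  rw [← evalAt_apply, piecewiseTranslation, star_sum, sum_apply, map_sum]
  refine Finset.sum_congr rfl fun i _ => ?_
  rw [evalAt_apply, star_mul, star_translation, star_diagonal, star_indicatorFunction,
    mul_apply_eq_comp, diagonal_apply_apply, translation_apply, inv_inv,
    indicatorFunction_apply]

/-- If the crossed product is finite, then `X` is not equidecomposable with a proper subset. -/
theorem not_equidecomposable_of_isFinite
    (h : IsFiniteCStarAlgebra (lInftyCrossedProduct G X)) :
    ¬ ∃ B : Set X, B ⊂ Set.univ ∧ Equidecomposable G Set.univ B := by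
  classical
  rintro ⟨B, hB, n, P, Q, s, hP, hPu, hQ, rfl, hs⟩
  have hmem (i : Fin n) (x : X) : s i • x ∈ Q i ↔ x ∈ P i := by
    rw [hs i, Set.smul_mem_smul_set_iff]
  have hmem' (i : Fin n) (x : X) : (s i)⁻¹ • x ∈ P i ↔ x ∈ Q i := by
    rw [← hmem, smul_inv_smul]
  have hiso : star (piecewiseTranslation P s) * piecewiseTranslation P s = 1 := by
    ext ξ g x
    rw [mul_apply_eq_comp, star_piecewiseTranslation_apply,
      one_apply_eq_self]
    -- Only the piece `P i` containing `g • x` contributes to the outer sum; in the inner sum only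
    -- `i` survives, as `s i • g • x` lies in `Q i` and in no other `Q j`.
    obtain ⟨i, hi⟩ := Set.mem_iUnion.1 (hPu ▸ Set.mem_univ (g • x))
    rw [Finset.sum_eq_single i, Set.indicator_of_mem hi, Pi.one_apply, one_mul,
      piecewiseTranslation_apply, Finset.sum_eq_single i]
    · simp [mul_smul, hi]
    · intro j _ hj
      have hji : (s j)⁻¹ • (s i * g) • x ∉ P j := by
        rw [hmem', mul_smul]
        exact Set.disjoint_left.1 (hQ hj.symm) ((hmem i _).2 hi)
      rw [Set.indicator_of_notMem hji, zero_mul]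
    · exact fun h => absurd (Finset.mem_univ i) h
    · intro j _ hj
      rw [Set.indicator_of_notMem (Set.disjoint_left.1 (hP hj.symm) hi), zero_mul]
    · exact fun h => absurd (Finset.mem_univ i) h
  have huni : piecewiseTranslation P s * star (piecewiseTranslation P s) = 1 :=
    congrArg Subtype.val (h ⟨_, piecewiseTranslation_mem P s⟩ (Subtype.ext hiso))
  obtain ⟨x, -, hx⟩ := Set.exists_of_ssubset hB
  -- The range of the isometry is supported on pairs `(g, y)` with `g • y ∈ B`. As `x ∉ B`, the
  -- diagonal coefficient at `(1, x)` is zero, whereas that of the identity is one.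
  have h1 := congrArg (fun T : ℓ²(G, ℓ²(X, ℂ)) →L[ℂ] ℓ²(G, ℓ²(X, ℂ)) =>
    T (lp.single 2 1 (lp.single 2 x 1)) 1 x) huni
  simp only [mul_apply_eq_comp, piecewiseTranslation_apply,
    one_apply_eq_self, lp.single_apply_self] at h1
  rw [Finset.sum_eq_zero] at h1
  · exact zero_ne_one h1
  · intro i _
    have hi : (s i)⁻¹ • (1 : G) • x ∉ P i := by
      rw [hmem', one_smul]
      exact fun hi => hx (Set.mem_iUnion.2 ⟨i, hi⟩)
    rw [Set.indicator_of_notMem hi, zero_mul]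

end Finite

/-! ### Basis vectors, right translations and their commutant -/

section Reindex

variable {ι E : Type*} [NormedAddCommGroup E] [InnerProductSpace ℂ E]

/-- The operator on `ℓ²(ι, E)` given by composition with a permutation of `ι`. -/
def reindex (E : Type*) [NormedAddCommGroup E] [InnerProductSpace ℂ E] (e : ι ≃ ι) :
    ℓ²(ι, E) →L[ℂ] ℓ²(ι, E) :=
  LinearMap.mkContinuous
    { toFun := fun ξ => ⟨fun i => ξ (e i), by
        have h := (lp.memℓp ξ).summable (by norm_num)
        exact memℓp_gen (e.summable_iff.mpr h)⟩
      map_add' := fun _ _ => rfl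
      map_smul' := fun _ _ => rfl } 1 <| fun ξ => by
    rw [one_mul, lp.norm_eq_tsum_rpow (by norm_num), lp.norm_eq_tsum_rpow (by norm_num)]
    exact le_of_eq (congrArg (· ^ (1 / (2 : ℝ≥0∞).toReal))
      (e.tsum_eq fun i => ‖ξ i‖ ^ (2 : ℝ≥0∞).toReal))

theorem reindex_apply (e : ι ≃ ι) (ξ : ℓ²(ι, E)) (i : ι) : reindex E e ξ i = ξ (e i) := rfl

theorem norm_reindex_le (e : ι ≃ ι) : ‖reindex E e‖ ≤ 1 :=
  LinearMap.mkContinuous_norm_le _ zero_le_one _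

end Reindex

section BasisVector

variable {G X : Type*}

open Classical in
/-- The basis vector of `ℓ²(G, ℓ²(X))` at `(g, x)`. -/
def basisVector (g : G) (x : X) : ℓ²(G, ℓ²(X, ℂ)) := lp.single 2 g (lp.single 2 x 1)

open Classical in
theorem basisVector_apply (g : G) (x : X) (h : G) (y : X) :
    basisVector g x h y = if h = g ∧ y = x then 1 else 0 := by
  unfold basisVector
  by_cases hg : h = g
  · subst hg
    rw [lp.single_apply_self, lp.single_apply, Pi.single_apply]
    simp
  · rw [lp.single_apply_ne _ _ _ hg]
    simp [hg]

theorem inner_basisVector_left (g : G) (x : X) (ξ : ℓ²(G, ℓ²(X, ℂ))) :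
    inner ℂ (basisVector g x) ξ = ξ g x := by
  classical
  unfold basisVector
  rw [lp.inner_single_left, lp.inner_single_left]
  simp

theorem translation_basisVector [Group G] (s g : G) (x : X) :
    translation _ s (basisVector g x) = basisVector (s * g) x := by
  ext h y
  rw [translation_apply, basisVector_apply, basisVector_apply, inv_mul_eq_iff_eq_mul]

end BasisVector

section RightTranslation

variable {G X : Type*} [Group G] [MulAction G X]

/-- The right translation `(ρ_t ξ)(g)(x) = ξ(g t)(t⁻¹ x)`. -/
def rightTranslation (X : Type*) [MulAction G X] (t : G) :
    ℓ²(G, ℓ²(X, ℂ)) →L[ℂ] ℓ²(G, ℓ²(X, ℂ)) :=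
  lp.mapCLM 2 (fun _ => reindex ℂ (MulAction.toPerm t⁻¹ : Equiv.Perm X)) zero_le_one
    (fun _ => norm_reindex_le _) * reindex _ (Equiv.mulRight t)

theorem rightTranslation_apply (t : G) (ξ : ℓ²(G, ℓ²(X, ℂ))) (g : G) (x : X) :
    rightTranslation X t ξ g x = ξ (g * t) (t⁻¹ • x) := rfl

/-- The operators commuting with all right translations. -/
def rightCommutant (G X : Type*) [Group G] [MulAction G X] :
    Subalgebra ℂ (ℓ²(G, ℓ²(X, ℂ)) →L[ℂ] ℓ²(G, ℓ²(X, ℂ))) :=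
  Subalgebra.centralizer ℂ (Set.range (rightTranslation X))

theorem commute_of_mem_rightCommutant {T : ℓ²(G, ℓ²(X, ℂ)) →L[ℂ] ℓ²(G, ℓ²(X, ℂ))}
    (hT : T ∈ rightCommutant G X) (t : G) : Commute (rightTranslation X t) T :=
  (Subalgebra.mem_centralizer_iff ℂ).1 hT _ ⟨t, rfl⟩

theorem apply_rightTranslation {T : ℓ²(G, ℓ²(X, ℂ)) →L[ℂ] ℓ²(G, ℓ²(X, ℂ))}
    (hT : T ∈ rightCommutant G X) (t : G) (ξ : ℓ²(G, ℓ²(X, ℂ))) :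
    T (rightTranslation X t ξ) = rightTranslation X t (T ξ) :=
  (congrArg (fun S : ℓ²(G, ℓ²(X, ℂ)) →L[ℂ] ℓ²(G, ℓ²(X, ℂ)) => S ξ)
    (commute_of_mem_rightCommutant hT t).eq).symm

/-- Needed for the inverse of `star a * a`, which is only given as a bounded operator and need not
lie in the algebraic crossed product. -/
theorem mem_rightCommutant_of_mul_eq_one {S T : ℓ²(G, ℓ²(X, ℂ)) →L[ℂ] ℓ²(G, ℓ²(X, ℂ))}
    (hT : T ∈ rightCommutant G X) (hST : S * T = 1) (hTS : T * S = 1) :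
    S ∈ rightCommutant G X := by
  refine (Subalgebra.mem_centralizer_iff ℂ).2 ?_
  rintro _ ⟨t, rfl⟩
  exact Commute.units_inv_right (u := ⟨T, S, hTS, hST⟩) (commute_of_mem_rightCommutant hT t)

theorem diagonal_mem_rightCommutant (f : ℓ^∞(X, ℂ)) :
    diagonal (multiplication X) (translationAction G X) f ∈ rightCommutant G X := by
  refine (Subalgebra.mem_centralizer_iff ℂ).2 ?_
  rintro _ ⟨t, rfl⟩
  ext ξ g x
  simp only [mul_apply_eq_comp]
  rw [rightTranslation_apply, diagonal_apply_apply, diagonal_apply_apply, rightTranslation_apply,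
    mul_smul, smul_inv_smul]

theorem translation_mem_rightCommutant (s : G) :
    translation ℓ²(X, ℂ) s ∈ rightCommutant G X := by
  refine (Subalgebra.mem_centralizer_iff ℂ).2 ?_
  rintro _ ⟨t, rfl⟩
  ext ξ g x
  simp only [mul_apply_eq_comp]
  rw [rightTranslation_apply, translation_apply, translation_apply, rightTranslation_apply,
    mul_assoc]

theorem adjoin_le_rightCommutant :
    Algebra.adjoin ℂ (Set.range (diagonal (multiplication X) (translationAction G X)) ∪
      Set.range (translation (G := G) ℓ²(X, ℂ))) ≤ rightCommutant G X := by
  refine Algebra.adjoin_le ?_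
  rintro _ (⟨f, rfl⟩ | ⟨s, rfl⟩)
  · exact diagonal_mem_rightCommutant f
  · exact translation_mem_rightCommutant s

theorem rightTranslation_basisVector (t g : G) (x : X) :
    rightTranslation X t (basisVector g x) = basisVector (g * t⁻¹) (t • x) := by
  ext h y
  rw [rightTranslation_apply, basisVector_apply, basisVector_apply, eq_mul_inv_iff_mul_eq,
    inv_smul_eq_iff]

theorem diagonal_basisVector (f : ℓ^∞(X, ℂ)) (g : G) (x : X) :
    diagonal (multiplication X) (translationAction G X) f (basisVector g x) =
      f (g • x) • basisVector g x := by
  ext h y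
  rw [diagonal_apply_apply]
  change _ = f (g • x) * basisVector g x h y
  rw [basisVector_apply]
  split_ifs with hh
  · rw [hh.1, hh.2]
  · simp

/-- An operator commuting with the right translations is determined by its values on the basis
vectors over the neutral element. -/
theorem eq_zero_of_basisVector_one {T : ℓ²(G, ℓ²(X, ℂ)) →L[ℂ] ℓ²(G, ℓ²(X, ℂ))}
    (hT : T ∈ rightCommutant G X) (h : ∀ x, T (basisVector 1 x) = 0) : T = 0 := by
  -- Every basis vector is a right translate of one over the neutral element.
  have hall (g : G) (x : X) : T (basisVector g x) = 0 := by
    have := rightTranslation_basisVector g⁻¹ 1 (g • x)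
    rw [inv_inv, one_mul, inv_smul_smul] at this
    rw [← this, apply_rightTranslation hT, h, map_zero]
  -- The coefficients of `star T ξ` are inner products of `T (basisVector g x)` with `ξ`; passing to
  -- the adjoint replaces a density argument.
  have hadj : star T = 0 := by
    ext ξ g x
    rw [← inner_basisVector_left, ContinuousLinearMap.star_eq_adjoint,
      ContinuousLinearMap.adjoint_inner_right, hall, inner_zero_left]
    rfl
  rw [← star_star T, hadj, star_zero]

end RightTranslation

/-! ### Traces over finite invariant sets -/

section Trace

variable {G X : Type*} [Group G]

/-- The sum of the diagonal matrix coefficients of an operator at the points `(1, y)`, `y ∈ O`. -/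
def partialTrace (O : Finset X) :
    (ℓ²(G, ℓ²(X, ℂ)) →L[ℂ] ℓ²(G, ℓ²(X, ℂ))) →ₗ[ℂ] ℂ where
  toFun T := ∑ y ∈ O, evalAt 1 y (T (basisVector 1 y))
  map_add' S T := by
    rw [← Finset.sum_add_distrib]
    exact Finset.sum_congr rfl fun y _ => map_add (evalAt 1 y) _ _
  map_smul' c T := by
    rw [RingHom.id_apply, Finset.smul_sum]
    exact Finset.sum_congr rfl fun y _ => map_smul (evalAt 1 y) c _

theorem partialTrace_apply (O : Finset X) (T : ℓ²(G, ℓ²(X, ℂ)) →L[ℂ] ℓ²(G, ℓ²(X, ℂ))) :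
    partialTrace O T = ∑ y ∈ O, T (basisVector 1 y) 1 y := rfl

variable [MulAction G X]

theorem partialTrace_diagonal_mul (O : Finset X) (f : ℓ^∞(X, ℂ))
    (T : ℓ²(G, ℓ²(X, ℂ)) →L[ℂ] ℓ²(G, ℓ²(X, ℂ))) :
    partialTrace O (diagonal (multiplication X) (translationAction G X) f * T) =
      partialTrace O (T * diagonal (multiplication X) (translationAction G X) f) := by
  rw [partialTrace_apply, partialTrace_apply]
  refine Finset.sum_congr rfl fun y _ => ?_
  rw [mul_apply_eq_comp, mul_apply_eq_comp, diagonal_apply_apply, diagonal_basisVector, map_smul,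
    one_smul]
  rfl

/-- Right translation by `s⁻¹` carries the basis vector at `(1, s • y)` to the one at `(s, y)`.
Hence the coefficient of `T λ_s` at `y` is that of `λ_s T` at `s • y`, and invariance of `O` allows
the reindexing. -/
theorem partialTrace_translation_mul {O : Finset X} {s : G} (hO : ∀ y, s • y ∈ O ↔ y ∈ O)
    {T : ℓ²(G, ℓ²(X, ℂ)) →L[ℂ] ℓ²(G, ℓ²(X, ℂ))} (hT : T ∈ rightCommutant G X) :
    partialTrace O (translation _ s * T) = partialTrace O (T * translation _ s) := by
  rw [partialTrace_apply, partialTrace_apply, eq_comm]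
  refine Finset.sum_equiv (MulAction.toPerm s) (fun y => (hO y).symm) fun y _ => ?_
  have h := rightTranslation_basisVector s⁻¹ 1 (s • y)
  rw [inv_inv, one_mul, inv_smul_smul] at h
  rw [mul_apply_eq_comp, mul_apply_eq_comp, translation_basisVector, mul_one, ← h,
    apply_rightTranslation hT, rightTranslation_apply, translation_apply, inv_inv, one_mul, mul_one]
  rfl

/-- For an element of the algebraic crossed product, only finitely many group elements matter for
the trace property. -/
theorem exists_finite_partialTrace_comm {a : ℓ²(G, ℓ²(X, ℂ)) →L[ℂ] ℓ²(G, ℓ²(X, ℂ))}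
    (ha : a ∈ Algebra.adjoin ℂ (Set.range (diagonal (multiplication X) (translationAction G X)) ∪
      Set.range (translation (G := G) ℓ²(X, ℂ)))) :
    ∃ F : Set G, F.Finite ∧ ∀ O : Finset X, (∀ s ∈ F, ∀ y, s • y ∈ O ↔ y ∈ O) →
      ∀ T ∈ rightCommutant G X, partialTrace O (a * T) = partialTrace O (T * a) := by
  induction ha using Algebra.adjoin_induction with
  | mem a ha =>
    rcases ha with ⟨f, rfl⟩ | ⟨s, rfl⟩
    · exact ⟨∅, Set.finite_empty, fun O _ T _ => partialTrace_diagonal_mul O f T⟩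
    · exact ⟨{s}, Set.finite_singleton s, fun O hO T hT =>
        partialTrace_translation_mul (hO s rfl) hT⟩
  | algebraMap r =>
    exact ⟨∅, Set.finite_empty, fun O _ T _ => by rw [Algebra.commutes]⟩
  | add a b _ _ iha ihb =>
    obtain ⟨F, hF, ha⟩ := iha
    obtain ⟨F', hF', hb⟩ := ihb
    refine ⟨F ∪ F', hF.union hF', fun O hO T hT => ?_⟩
    rw [add_mul, mul_add, map_add, map_add, ha O (fun s hs => hO s (Or.inl hs)) T hT,
      hb O (fun s hs => hO s (Or.inr hs)) T hT]
  | mul a b hma hmb iha ihb =>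
    obtain ⟨F, hF, ha⟩ := iha
    obtain ⟨F', hF', hb⟩ := ihb
    -- Cycle one factor at a time, `abT ↦ bTa ↦ Tab`; this is why `T` ranges over the whole
    -- commutant, which contains `bT` and `Ta`.
    refine ⟨F ∪ F', hF.union hF', fun O hO T hT => ?_⟩
    rw [mul_assoc, ha O (fun s hs => hO s (Or.inl hs)) _
        (mul_mem (adjoin_le_rightCommutant hmb) hT), mul_assoc,
      hb O (fun s hs => hO s (Or.inr hs)) _ (mul_mem hT (adjoin_le_rightCommutant hma)), mul_assoc]

/-- A projection commuting with the right translations vanishes if it has zero trace over a family of finite sets covering `X`. -/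
theorem eq_zero_of_partialTrace_eq_zero {p : ℓ²(G, ℓ²(X, ℂ)) →L[ℂ] ℓ²(G, ℓ²(X, ℂ))}
    (hp : IsStarProjection p) (hpc : p ∈ rightCommutant G X)
    (h : ∀ x, ∃ O : Finset X, x ∈ O ∧ partialTrace O p = 0) : p = 0 := by
  refine eq_zero_of_basisVector_one hpc fun x => ?_
  obtain ⟨O, hx, hO⟩ := h x
  -- Since `p = p⋆p`, the diagonal coefficients are squared norms, so a vanishing sum forces each of
  -- them to vanish.
  have hterm (y : X) : p (basisVector 1 y) 1 y = ((‖p (basisVector 1 y)‖ ^ 2 : ℝ) : ℂ) := by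
    rw [← inner_basisVector_left]
    conv_lhs => rw [← hp.isIdempotentElem.eq, mul_apply_eq_comp]
    nth_rw 1 [← hp.isSelfAdjoint.star_eq]
    rw [ContinuousLinearMap.star_eq_adjoint, ContinuousLinearMap.adjoint_inner_right,
      inner_self_eq_norm_sq_to_K]
    push_cast
    rfl
  rw [partialTrace_apply, Finset.sum_congr rfl fun y _ => hterm y, ← Complex.ofReal_sum,
    Complex.ofReal_eq_zero, Finset.sum_eq_zero_iff_of_nonneg fun y _ => sq_nonneg _] at hO
  exact norm_eq_zero.1 (pow_eq_zero_iff two_ne_zero |>.1 (hO x hx))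

/-- For a locally finite action, an element `a` of the algebraic crossed product is invertible
as soon as `a⋆a` is. -/
theorem isUnit_of_locallyFinite (hG : LocallyFiniteAction G X)
    {a : ℓ²(G, ℓ²(X, ℂ)) →L[ℂ] ℓ²(G, ℓ²(X, ℂ))}
    (ha : a ∈ StarAlgebra.adjoin ℂ
      (Set.range (diagonal (multiplication X) (translationAction G X)) ∪
        Set.range (translation (G := G) ℓ²(X, ℂ))))
    (hu : IsUnit (star a * a)) : IsUnit a := by
  have hmem {b : ℓ²(G, ℓ²(X, ℂ)) →L[ℂ] ℓ²(G, ℓ²(X, ℂ))} (hb : b ∈ StarAlgebra.adjoin ℂ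
      (Set.range (diagonal (multiplication X) (translationAction G X)) ∪
        Set.range (translation (G := G) ℓ²(X, ℂ)))) :
      b ∈ Algebra.adjoin ℂ (Set.range (diagonal (multiplication X) (translationAction G X)) ∪
        Set.range (translation (G := G) ℓ²(X, ℂ))) := by
    rw [← adjoin_generators_eq]
    exact hb
  have hac : a ∈ rightCommutant G X := adjoin_le_rightCommutant (hmem ha)
  have hac' : star a ∈ rightCommutant G X := adjoin_le_rightCommutant (hmem (star_mem ha))
  obtain ⟨c, hc, hc'⟩ := isUnit_iff_exists.1 hu
  have hcc : c ∈ rightCommutant G X :=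
    mem_rightCommutant_of_mul_eq_one (mul_mem hac' hac) hc' hc
  have hcs : star c = c := by
    refine left_inv_eq_right_inv (a := star a * a) ?_ hc
    have h := congrArg star hc
    rwa [star_mul, star_mul, star_star, star_one] at h
  have hb : c * star a * a = 1 := by rw [mul_assoc, hc']
  -- With `c = (a⋆a)⁻¹`, the operator `a c a⋆` is the range projection of `a`.
  have hq : IsStarProjection (a * (c * star a)) := by
    refine ⟨?_, ?_⟩
    · change a * (c * star a) * (a * (c * star a)) = _
      rw [mul_assoc, ← mul_assoc (c * star a), hb, one_mul]
    · change star (a * (c * star a)) = _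
      rw [star_mul, star_mul, star_star, hcs, mul_assoc]
  have hbc : c * star a ∈ rightCommutant G X := mul_mem hcc hac'
  obtain ⟨F, hF, htr⟩ := exists_finite_partialTrace_comm (hmem ha)
  have h0 : 1 - a * (c * star a) = 0 := by
    refine eq_zero_of_partialTrace_eq_zero hq.one_sub
      (sub_mem (one_mem _) (mul_mem hac hbc)) fun x => ?_
    -- The orbit of `x` under the subgroup generated by `F` is finite and `F`-invariant. On it, `a
    -- (c a⋆)` has the same trace as `(c a⋆) a = 1`.
    have hfin := hG (Subgroup.closure F) ((Subgroup.fg_iff _).2 ⟨F, rfl, hF⟩) x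
    refine ⟨hfin.toFinset, hfin.mem_toFinset.2 (MulAction.mem_orbit_self x), ?_⟩
    rw [map_sub, htr _ ?_ _ hbc, hb, sub_self]
    intro s hs y
    rw [hfin.mem_toFinset, hfin.mem_toFinset]
    let t : Subgroup.closure F := ⟨s, Subgroup.subset_closure hs⟩
    change t • y ∈ _ ↔ _
    rw [← MulAction.orbit_eq_iff, MulAction.orbit_smul, MulAction.orbit_eq_iff]
  exact isUnit_iff_exists.2 ⟨c * star a, (sub_eq_zero.1 h0).symm, hb⟩

end Trace

/-! ### From the dense subalgebra to the closure -/

/-- If `v` is an isometry in a unital C⋆-algebra and elements of the dense set `S` are invertible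
as soon as `a⋆a` is, then `v` is unitary. -/
theorem mul_star_eq_one_of_mem_closure {B : Type*} [CStarAlgebra B] {S : Set B}
    (hS : ∀ a ∈ S, IsUnit (star a * a) → IsUnit a) {v : B} (hv : v ∈ closure S)
    (hiso : star v * v = 1) : v * star v = 1 := by
  -- Both conditions hold at `a = v`, hence at some `a ∈ S` near `v`. The first makes `a`
  -- invertible, then the second makes `star v` invertible, and an invertible isometry is unitary.
  have hU : IsOpen {a : B | IsUnit (star a * a) ∧ IsUnit (star v * a)} :=
    (Units.isOpen.preimage (continuous_star.mul continuous_id)).inter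
      (Units.isOpen.preimage (continuous_const.mul continuous_id))
  obtain ⟨a, ⟨ha, hva⟩, haS⟩ := mem_closure_iff.1 hv _ hU
    ⟨by rw [hiso]; exact isUnit_one, by rw [hiso]; exact isUnit_one⟩
  have hau := hS a haS ha
  have hvu : IsUnit (star v) := by
    obtain ⟨u, rfl⟩ := hau
    exact (Units.isUnit_mul_units _ u).1 hva
  obtain ⟨u, hu⟩ := hvu
  rw [← hu] at hiso ⊢
  rw [← Units.inv_eq_of_mul_eq_one_right hiso, Units.inv_mul]

/-- If the action is locally finite, then the crossed product is finite. -/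
theorem isFinite_of_locallyFinite {G X : Type*} [Group G] [MulAction G X]
    (hG : LocallyFiniteAction G X) : IsFiniteCStarAlgebra (lInftyCrossedProduct G X) := by
  intro v hv
  refine Subtype.ext (mul_star_eq_one_of_mem_closure
    (fun a ha hu => isUnit_of_locallyFinite hG ha hu) v.2 ?_)
  exact congrArg Subtype.val hv

end CrossedProduct

end

theorem theorem2p3 (G X : Type*) [Group G] [MulAction G X] :
    List.TFAE [
      CrossedProduct.LocallyFiniteAction G X,
      CrossedProduct.IsFiniteCStarAlgebra (CrossedProduct.lInftyCrossedProduct G X),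
      ¬ ∃ B : Set X, B ⊂ Set.univ ∧ CrossedProduct.Equidecomposable G Set.univ B,
      ¬ ∃ A B : Set X, B ⊂ A ∧ CrossedProduct.Equidecomposable G A B] := by
  tfae_have 1 → 2 := CrossedProduct.isFinite_of_locallyFinite
  tfae_have 2 → 3 := CrossedProduct.not_equidecomposable_of_isFinite
  tfae_have 3 → 1 := CrossedProduct.locallyFiniteAction_of_not_equidecomposable
  tfae_have 4 → 3 := fun h ⟨B, hB⟩ => h ⟨Set.univ, B, hB⟩
  tfae_have 3 → 4 := by
    rintro h ⟨A, B, hBA, he⟩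
    refine h ⟨B ∪ Aᶜ, ?_, he.univ_union_compl hBA.subset⟩
    obtain ⟨x, hxA, hxB⟩ := Set.exists_of_ssubset hBA
    refine Set.ssubset_univ_iff.2 fun hu => ?_
    rcases (hu ▸ Set.mem_univ x : x ∈ B ∪ Aᶜ) with hx | hx
    · exact hxB hx
    · exact hx hxA
  tfae_finish
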